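/- Let $K$ be a field of characteristic different from $2$, and let $n$ be an odd positive integer. Let $(Q_1,\sigma_1),\dots,(Q_n,\sigma_n)$ be quaternion algebras over $K$ with involutions of the first kind (that is, $K$-linear ring anti-automorphisms $\sigma_i$ of $Q_i$ with $\sigma_i^2=\mathrm{id}$), and let $$(A,\sigma)=(Q_1,\sigma_1)\otimes_K\cdots\otimes_K(Q_n,\sigma_n).$$ Here an involution of the first kind on a central simple $K$-algebra of degree $d$ (i.e. of dimension $d^2$) is called orthogonal if its space of symmetric elements has dimension $d(d+1)/2$, and symplectic if this dimension is $d(d-1)/2$. For a quadratic space $(V,q)$ with Clifford algebra $C(V,q)$ (in which $x^2=q(x)$ for $x\in V$), let $J_q^{\mathrm{id}}$ and $J_q^{-\mathrm{id}}$ denote the unique involutions of $C(V,q)$ that fix $K$ and satisfy $J_q^{\mathrm{id}}(x)=x$, respectively $J_q^{-\mathrm{id}}(x)=-x$, for all $x\in V$. Then: (a) If $n\equiv 1 \pmod 4$ and $\sigma$ is symplectic, there is a nondegenerate quadratic space $(V,q)$ of dimension $2n$ over $K$ such that $(A,\sigma)\simeq(C(V,q),J_q^{-\mathrm{id}})$.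 (b) If $n\equiv 1 \pmod 4$ and $\sigma$ is orthogonal, there is a nondegenerate quadratic space $(V,q)$ of dimension $2n$ over $K$ such that $(A,\sigma)\simeq(C(V,q),J_q^{\mathrm{id}})$. (c) If $n\equiv 3 \pmod 4$ and $\sigma$ is symplectic, there is a nondegenerate quadratic space $(V,q)$ of dimension $2n$ over $K$ such that $(A,\sigma)\simeq(C(V,q),J_q^{\mathrm{id}})$. (d) If $n\equiv 3 \pmod 4$ and $\sigma$ is orthogonal, there is a nondegenerate quadratic space $(V,q)$ of dimension $2n$ over $K$ such that $(A,\sigma)\simeq(C(V,q),J_q^{-\mathrm{id}})$. All isomorphisms are isomorphisms of $K$-algebras with involution. -/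

import Mathlib

universe u v

open scoped TensorProduct

/-- A `K`-algebra is a quaternion algebra if it is isomorphic to some `(a, b)_K` with
`a, b ∈ Kˣ`, i.e. the algebra with basis `1, i, j, ij` and relations
`i² = a`, `j² = b`, `ij = -ji`. -/
def IsQuaternionAlgebra (K : Type*) [Field K] (Q : Type*) [Ring Q] [Algebra K Q] : Prop :=
  ∃ a b : K, a ≠ 0 ∧ b ≠ 0 ∧ Nonempty (Q ≃ₐ[K] QuaternionAlgebra K a 0 b)

/-- An involution of the first kind of a `K`-algebra `A`: an anti-automorphism of the ring `A`
which is its own inverse and fixes `K`, i.e. is `K`-linear. -/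
structure AlgInvolution (K : Type*) [Field K] (A : Type*) [Ring A] [Algebra K A]
    extends A →ₗ[K] A where
  map_mul_rev : ∀ x y : A, toFun (x * y) = toFun y * toFun x
  involutive : ∀ x : A, toFun (toFun x) = x

namespace AlgInvolution

/-- Isomorphism `(A, σ) ≃ (B, τ)` of `K`-algebras with involution. -/
def Isomorphic {K : Type*} [Field K] {A B : Type*} [Ring A] [Algebra K A] [Ring B] [Algebra K B]
    (σ : AlgInvolution K A) (τ : AlgInvolution K B) : Prop :=
  ∃ f : A ≃ₐ[K] B, ∀ x : A, f (σ.toLinearMap x) = τ.toLinearMap (f x)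

/-- The `K`-subspace of symmetric elements `{x | σ x = x}`. -/
def symmetricElements {K : Type*} [Field K] {A : Type*} [Ring A] [Algebra K A]
    (σ : AlgInvolution K A) : Submodule K A :=
  LinearMap.eqLocus σ.toLinearMap LinearMap.id

/-- Orthogonal type, for an involution of the first kind on a central simple algebra of degree `d`
in characteristic different from `2`: the space of symmetric elements has
dimension `d (d + 1) / 2`. -/
def IsOrthogonal {K : Type*} [Field K] {A : Type*} [Ring A] [Algebra K A]
    (σ : AlgInvolution K A) : Prop :=
  ∃ d : ℕ, Module.finrank K A = d ^ 2 ∧ 2 * Module.finrank K σ.symmetricElements = d * (d + 1)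

/-- Symplectic type, for an involution of the first kind on a central simple algebra of degree `d`
in characteristic different from `2`: the space of symmetric elements has
dimension `d (d - 1) / 2`. -/
def IsSymplectic {K : Type*} [Field K] {A : Type*} [Ring A] [Algebra K A]
    (σ : AlgInvolution K A) : Prop :=
  ∃ d : ℕ, Module.finrank K A = d ^ 2 ∧ 2 * Module.finrank K σ.symmetricElements = d * (d - 1)

/-- The involution `σ₁ ⊗ ⋯ ⊗ σₙ` of `A₁ ⊗ ⋯ ⊗ Aₙ`,
`x₁ ⊗ ⋯ ⊗ xₙ ↦ σ₁ x₁ ⊗ ⋯ ⊗ σₙ xₙ`. -/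
noncomputable def piTensor {K : Type*} [Field K] {ι : Type*} {A : ι → Type*}
    [∀ i, Ring (A i)] [∀ i, Algebra K (A i)] (σ : ∀ i, AlgInvolution K (A i)) :
    AlgInvolution K (⨂[K] i, A i) where
  toLinearMap := PiTensorProduct.map fun i => (σ i).toLinearMap
  map_mul_rev x y := by
    change PiTensorProduct.map (fun i => (σ i).toLinearMap) (x * y) =
      PiTensorProduct.map (fun i => (σ i).toLinearMap) y *
        PiTensorProduct.map (fun i => (σ i).toLinearMap) x
    induction x using PiTensorProduct.induction_on with
    | smul_tprod r a =>
      induction y using PiTensorProduct.induction_on with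
      | smul_tprod s b =>
        simp only [PiTensorProduct.smul_tprod_mul_smul_tprod, map_smul, PiTensorProduct.map_tprod]
        rw [mul_comm r s]
        congr 2
        funext i
        exact (σ i).map_mul_rev (a i) (b i)
      | add y₁ y₂ h₁ h₂ => rw [mul_add, map_add, map_add, add_mul, h₁, h₂]
    | add x₁ x₂ h₁ h₂ => rw [add_mul, map_add, map_add, mul_add, h₁, h₂]
  involutive x := by
    change PiTensorProduct.map (fun i => (σ i).toLinearMap)
      (PiTensorProduct.map (fun i => (σ i).toLinearMap) x) = x
    induction x using PiTensorProduct.induction_on with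
    | smul_tprod r a =>
      simp only [map_smul, PiTensorProduct.map_tprod]
      congr 2
      funext i
      exact (σ i).involutive (a i)
    | add x₁ x₂ h₁ h₂ => rw [map_add, map_add, h₁, h₂]

end AlgInvolution

/-- An orthogonal symmetry of a quadratic space: an isometry `s` with `s ∘ s = id`. -/
structure OrthogonalSymmetry {K : Type*} [Field K] {V : Type*} [AddCommGroup V] [Module K V]
    (q : QuadraticForm K V) where
  toIsometry : QuadraticMap.Isometry q q
  involutive : ∀ x : V, toIsometry (toIsometry x) = x

namespace OrthogonalSymmetry

/-- The orthogonal symmetry `id`. -/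
def id {K : Type*} [Field K] {V : Type*} [AddCommGroup V] [Module K V]
    (q : QuadraticForm K V) : OrthogonalSymmetry q where
  toIsometry := QuadraticMap.Isometry.id q
  involutive _ := rfl

/-- The orthogonal symmetry `-id`. -/
def negId {K : Type*} [Field K] {V : Type*} [AddCommGroup V] [Module K V]
    (q : QuadraticForm K V) : OrthogonalSymmetry q where
  toIsometry :=
    { toLinearMap := -LinearMap.id
      map_app' := fun x => q.map_neg x }
  involutive x := neg_neg x

/-- The involution `J_q^s` of the Clifford algebra `C(V, q)` induced by an orthogonal symmetry `s`:
the composition of the automorphism of `C(V, q)` extending `s` with the reversion. By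
`OrthogonalSymmetry.cliffordInvolution_ι` and `OrthogonalSymmetry.cliffordInvolution_unique` it is
the unique involution of `C(V, q)` fixing `K` and mapping each `x ∈ V` to `s x`. -/
noncomputable def cliffordInvolution {K : Type*} [Field K] {V : Type*} [AddCommGroup V]
    [Module K V] {q : QuadraticForm K V} (s : OrthogonalSymmetry q) :
    AlgInvolution K (CliffordAlgebra q) where
  toLinearMap := CliffordAlgebra.reverse ∘ₗ (CliffordAlgebra.map s.toIsometry).toLinearMap
  map_mul_rev x y := by
    change CliffordAlgebra.reverse (CliffordAlgebra.map s.toIsometry (x * y)) =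
      CliffordAlgebra.reverse (CliffordAlgebra.map s.toIsometry y) *
        CliffordAlgebra.reverse (CliffordAlgebra.map s.toIsometry x)
    rw [map_mul, CliffordAlgebra.reverse.map_mul]
  involutive x := by
    change CliffordAlgebra.reverse (CliffordAlgebra.map s.toIsometry
      (CliffordAlgebra.reverse (CliffordAlgebra.map s.toIsometry x))) = x
    induction x using CliffordAlgebra.induction with
    | algebraMap r => simp
    | ι v => simp [s.involutive]
    | mul a b ha hb => simp only [map_mul, CliffordAlgebra.reverse.map_mul, ha, hb]
    | add a b ha hb => simp only [map_add, ha, hb]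

theorem cliffordInvolution_ι {K : Type*} [Field K] {V : Type*} [AddCommGroup V]
    [Module K V] {q : QuadraticForm K V} (s : OrthogonalSymmetry q) (x : V) :
    s.cliffordInvolution.toLinearMap (CliffordAlgebra.ι q x) =
      CliffordAlgebra.ι q (s.toIsometry x) := by
  change CliffordAlgebra.reverse (CliffordAlgebra.map s.toIsometry (CliffordAlgebra.ι q x)) = _
  simp

theorem cliffordInvolution_unique {K : Type*} [Field K] {V : Type*} [AddCommGroup V]
    [Module K V] {q : QuadraticForm K V} (s : OrthogonalSymmetry q)
    (τ : AlgInvolution K (CliffordAlgebra q))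
    (h : ∀ x : V, τ.toLinearMap (CliffordAlgebra.ι q x) = CliffordAlgebra.ι q (s.toIsometry x))
    (x : CliffordAlgebra q) : τ.toLinearMap x = s.cliffordInvolution.toLinearMap x := by
  have one : ∀ σ : AlgInvolution K (CliffordAlgebra q), σ.toLinearMap 1 = 1 := fun σ => by
    have h₁ := σ.map_mul_rev (σ.toLinearMap 1) 1
    have h₂ : σ.toLinearMap (σ.toLinearMap 1) = 1 := σ.involutive 1
    change σ.toLinearMap (σ.toLinearMap 1 * 1) =
      σ.toLinearMap 1 * σ.toLinearMap (σ.toLinearMap 1) at h₁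
    rw [mul_one, h₂, mul_one] at h₁
    exact h₁.symm
  have mul : ∀ (σ : AlgInvolution K (CliffordAlgebra q)) (a b : CliffordAlgebra q),
      σ.toLinearMap (a * b) = σ.toLinearMap b * σ.toLinearMap a := fun σ => σ.map_mul_rev
  induction x using CliffordAlgebra.induction with
  | algebraMap r => simp only [Algebra.algebraMap_eq_smul_one, map_smul, one]
  | ι v => rw [h, cliffordInvolution_ι]
  | mul a b ha hb => rw [mul, mul, ha, hb]
  | add a b ha hb => rw [map_add, map_add, ha, hb]

end OrthogonalSymmetry

/-!
Each factor `(Q k, σ k)` has anticommuting generators `x k`, `y k` with nonzero scalar squares which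
`σ k` multiplies by the same sign `t k` (`IsQuaternionAlgebra.exists_isStandardPair`); the product
`w k = x k * y k` is then always skew. The pure tensors in `1, x k, y k, w k` form a basis of
eigenvectors of `σ`, so counting the symmetric ones gives `2 dim Sym = 4 ^ n + 2 ^ n ∏ t k`: the
involution is orthogonal or symplectic according to whether `∏ t k` is `1` or `-1`
(`QuaternionTensor.two_mul_finrank_symmetricElements`).

Generators of different factors commute. To make them anticommute, choose a tournament on the
factors and multiply `x k` and `y k` by the product of all `w l` with an edge from `k` to `l`
(`QuaternionTensor.twist`). Generators at `k ≠ l` then anticommute, since exactly one of the two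
edges is present, and `σ` multiplies those at `k` by `t k` times the parity sign of the out-degree
of `k`. Out-degree parities can be prescribed arbitrarily, as long as they add up to the parity of
the number `n (n - 1) / 2` of edges (`exists_tournament`). So all `2 n` twisted generators can be
given a common sign `ε` precisely when `∏ (ε t k) = (-1) ^ (n (n - 1) / 2)`. For odd `n` this reads
`ε ∏ t k = (-1) ^ ((n - 1) / 2)`, and determines `ε` from the type of `σ` and `n` modulo `4`.

The twisted generators still generate the tensor product, whose dimension `2 ^ (2 n)` is that of
the Clifford algebra of the diagonal form given by their squares, so the two algebras are isomorphic
(`CliffordAlgebra.exists_algEquiv_of_anticomm`), and `σ` corresponds to the involution that is `ε`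
on the quadratic space.
-/

/-! ### Involutions of the first kind on quaternion algebras -/

namespace AlgInvolution

variable {K : Type*} [Field K] {A : Type*} [Ring A] [Algebra K A]

theorem map_mul_rev' (σ : AlgInvolution K A) (x y : A) :
    σ.toLinearMap (x * y) = σ.toLinearMap y * σ.toLinearMap x :=
  σ.map_mul_rev x y

theorem apply_apply (σ : AlgInvolution K A) (x : A) : σ.toLinearMap (σ.toLinearMap x) = x :=
  σ.involutive x

theorem map_one' (σ : AlgInvolution K A) : σ.toLinearMap 1 = 1 := by
  have h := σ.map_mul_rev' (σ.toLinearMap 1) 1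
  rwa [mul_one, σ.apply_apply, mul_one, eq_comm] at h

/-- Transport of an involution along an algebra isomorphism. -/
def transport {B : Type*} [Ring B] [Algebra K B] (σ : AlgInvolution K A) (f : A ≃ₐ[K] B) :
    AlgInvolution K B where
  toLinearMap := f.toLinearMap ∘ₗ σ.toLinearMap ∘ₗ f.symm.toLinearMap
  map_mul_rev x y := by
    change f (σ.toLinearMap (f.symm (x * y))) =
      f (σ.toLinearMap (f.symm y)) * f (σ.toLinearMap (f.symm x))
    rw [map_mul, map_mul_rev', map_mul]
  involutive x := by
    change f (σ.toLinearMap (f.symm (f (σ.toLinearMap (f.symm x))))) = x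
    simp [apply_apply]

theorem transport_apply {B : Type*} [Ring B] [Algebra K B] (σ : AlgInvolution K A)
    (f : A ≃ₐ[K] B) (x : B) :
    (σ.transport f).toLinearMap x = f (σ.toLinearMap (f.symm x)) :=
  rfl

/-- If squares of elements of a `σ`-stable subspace `P` are scalars, not all zero, then `P` contains
an eigenvector of `σ` with nonzero square: `(v + σ v)² + (v - σ v)² = 4 v²`. -/
theorem exists_eigenvector (h2 : (2 : K) ≠ 0) (σ : AlgInvolution K A) (P : Submodule K A)
    (hP : ∀ v ∈ P, σ.toLinearMap v ∈ P) (hsq : ∀ v ∈ P, ∃ c : K, v * v = c • (1 : A))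
    (hne : ∃ v ∈ P, v * v ≠ 0) :
    ∃ v ∈ P, ∃ (c : K) (s : ℤˣ), c ≠ 0 ∧ v * v = c • (1 : A) ∧
      σ.toLinearMap v = ((s : ℤ) : K) • v := by
  obtain ⟨v, hv, hvv⟩ := hne
  have hσv := hP v hv
  suffices h : ∃ u ∈ P, u * u ≠ 0 ∧ ∃ s : ℤˣ, σ.toLinearMap u = ((s : ℤ) : K) • u by
    obtain ⟨u, hu, huu, s, hs⟩ := h
    obtain ⟨c, hc⟩ := hsq u hu
    refine ⟨u, hu, c, s, ?_, hc, hs⟩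
    rintro rfl
    simp [hc] at huu
  by_contra! hcon
  have hp : (v + σ.toLinearMap v) * (v + σ.toLinearMap v) = 0 := by
    by_contra h
    exact hcon _ (P.add_mem hv hσv) h 1 (by simp [apply_apply, add_comm])
  have hm : (v - σ.toLinearMap v) * (v - σ.toLinearMap v) = 0 := by
    by_contra h
    exact hcon _ (P.sub_mem hv hσv) h (-1) (by simp [apply_apply])
  have hfix : σ.toLinearMap v * σ.toLinearMap v = v * v := by
    obtain ⟨c, hc⟩ := hsq v hv
    rw [← map_mul_rev', hc, map_smul, map_one']
  have h4 : (4 : K) • (v * v) = 0 := by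
    have h : (4 : K) • (v * v) = (v + σ.toLinearMap v) * (v + σ.toLinearMap v) +
        (v - σ.toLinearMap v) * (v - σ.toLinearMap v) := by
      rw [add_mul, mul_add, mul_add, sub_mul, mul_sub, mul_sub, hfix]
      module
    rw [h, hp, hm, add_zero]
  have h4' : (4 : K) ≠ 0 := by
    rw [show (4 : K) = 2 * 2 by norm_num]
    exact mul_ne_zero h2 h2
  exact hvv ((smul_eq_zero.1 h4).resolve_left h4')

end AlgInvolution

/-- Standard generators of a quaternion algebra with involution: anticommuting elements `x`, `y`
with squares `a, b ∈ Kˣ`, both of which `σ` multiplies by the same sign `t`. The involution is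
symplectic if `t = -1` and orthogonal if `t = 1`. -/
structure IsStandardPair {K : Type*} [Field K] {Q : Type*} [Ring Q] [Algebra K Q]
    (σ : AlgInvolution K Q) (x y : Q) (a b : K) (t : ℤˣ) : Prop where
  left_ne : a ≠ 0
  right_ne : b ≠ 0
  left_sq : x * x = a • (1 : Q)
  right_sq : y * y = b • (1 : Q)
  anticomm : y * x = -(x * y)
  map_left : σ.toLinearMap x = ((t : ℤ) : K) • x
  map_right : σ.toLinearMap y = ((t : ℤ) : K) • y

namespace QuaternionAlgebra

variable {K : Type*} [Field K] {a b : K}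

/-- The subspace of pure quaternions. -/
def pure (a b : K) : Submodule K (QuaternionAlgebra K a 0 b) :=
  LinearMap.ker (reₗ a 0 b)

theorem mem_pure {v : QuaternionAlgebra K a 0 b} : v ∈ pure a b ↔ v.re = 0 :=
  Iff.rfl

theorem mul_self_of_mem_pure {v : QuaternionAlgebra K a 0 b} (hv : v ∈ pure a b) :
    v * v = (a * v.imI ^ 2 + b * v.imJ ^ 2 - a * b * v.imK ^ 2) •
      (1 : QuaternionAlgebra K a 0 b) := by
  rw [mem_pure] at hv
  ext <;> simp [hv] <;> ring

/-- Pure quaternions are the nonscalar elements with scalar square, together with `0`, so every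
involution of the first kind preserves them. -/
theorem map_mem_pure (h2 : (2 : K) ≠ 0) (σ : AlgInvolution K (QuaternionAlgebra K a 0 b))
    {v : QuaternionAlgebra K a 0 b} (hv : v ∈ pure a b) : σ.toLinearMap v ∈ pure a b := by
  have hsq : σ.toLinearMap v * σ.toLinearMap v = v * v := by
    rw [← AlgInvolution.map_mul_rev', mul_self_of_mem_pure hv, map_smul, AlgInvolution.map_one']
  rw [mul_self_of_mem_pure hv] at hsq
  rw [mem_pure]
  by_contra hre
  have hI := congr_arg imI hsq
  have hJ := congr_arg imJ hsq
  have hL := congr_arg imK hsq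
  simp at hI hJ hL
  have key : ∀ z : K, 2 * ((σ.toLinearMap v).re * z) = 0 → z = 0 := fun z hz =>
    ((mul_eq_zero.1 ((mul_eq_zero.1 hz).resolve_left h2)).resolve_left hre)
  have hI' := key (σ.toLinearMap v).imI (by linear_combination hI)
  have hJ' := key (σ.toLinearMap v).imJ (by linear_combination hJ)
  have hL' := key (σ.toLinearMap v).imK (by linear_combination hL)
  have hs : σ.toLinearMap v = (σ.toLinearMap v).re • (1 : QuaternionAlgebra K a 0 b) := by
    ext <;> simp [hI', hJ', hL']
  have hv' := congr_arg σ.toLinearMap hs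
  rw [AlgInvolution.apply_apply, map_smul, AlgInvolution.map_one'] at hv'
  rw [mem_pure, hv'] at hv
  simp at hv
  exact hre hv

/-- The orthogonal complement of an anisotropic pure quaternion `x` is not totally isotropic: it
contains `p x - x p` for `p = i, j, k`, and these cannot all have square zero. -/
theorem exists_anticomm (h2 : (2 : K) ≠ 0) (ha : a ≠ 0) (hb : b ≠ 0)
    {x : QuaternionAlgebra K a 0 b} (hx : x ∈ pure a b) (hxx : x * x ≠ 0) :
    ∃ u ∈ pure a b, u * x = -(x * u) ∧ u * u ≠ 0 := by
  by_contra! hcon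
  rw [mul_self_of_mem_pure hx] at hxx
  rw [mem_pure] at hx
  have key : ∀ p ∈ pure a b, (p * x - x * p) * (p * x - x * p) = 0 := by
    intro p hp
    rw [mem_pure] at hp
    refine hcon _ ?_ ?_
    · rw [mem_pure]
      simp [hx, hp]
      ring
    · ext <;> simp [hx, hp] <;> ring
  have h4 : (4 : K) ≠ 0 := by
    rw [show (4 : K) = 2 * 2 by norm_num]
    exact mul_ne_zero h2 h2
  have hI := congr_arg re (key ⟨0, 1, 0, 0⟩ rfl)
  have hJ := congr_arg re (key ⟨0, 0, 1, 0⟩ rfl)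
  have hL := congr_arg re (key ⟨0, 0, 0, 1⟩ rfl)
  simp [hx] at hI hJ hL
  have hI' : b * x.imJ ^ 2 - a * b * x.imK ^ 2 = 0 := by
    refine (mul_eq_zero.1 ?_).resolve_left (mul_ne_zero h4 ha)
    linear_combination -hI
  have hJ' : a * x.imI ^ 2 - a * b * x.imK ^ 2 = 0 := by
    refine (mul_eq_zero.1 ?_).resolve_left (mul_ne_zero h4 hb)
    linear_combination -hJ
  have hL' : a * x.imI ^ 2 + b * x.imJ ^ 2 = 0 := by
    refine (mul_eq_zero.1 ?_).resolve_left (mul_ne_zero h4 (mul_ne_zero ha hb))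
    linear_combination hL
  apply hxx
  have h0 : a * x.imI ^ 2 + b * x.imJ ^ 2 - a * b * x.imK ^ 2 = 0 := by
    refine (mul_eq_zero.1 ?_).resolve_left h2
    linear_combination hI' + hJ' + hL'
  rw [h0, zero_smul]

/-- Two anticommuting anisotropic pure quaternions `x`, `u` can be taken to be eigenvectors of `σ`.
If their signs differ, one of the pairs `(x, x u)` and `(u, x u)` has equal signs, because
`σ (x u) = -ε₁ ε₂ x u`. -/
theorem exists_isStandardPair (h2 : (2 : K) ≠ 0) (ha : a ≠ 0) (hb : b ≠ 0)
    (σ : AlgInvolution K (QuaternionAlgebra K a 0 b)) :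
    ∃ x y c d t, IsStandardPair σ x y c d t := by
  obtain ⟨x, hx, c, s, hc, hxx, hsx⟩ := σ.exists_eigenvector h2 (pure a b)
    (fun v hv => map_mem_pure h2 σ hv) (fun v hv => ⟨_, mul_self_of_mem_pure hv⟩)
    ⟨⟨0, 1, 0, 0⟩, rfl, by simp [QuaternionAlgebra.ext_iff, ha]⟩
  let P : Submodule K (QuaternionAlgebra K a 0 b) := pure a b ⊓
    LinearMap.ker (LinearMap.mulLeft K x + LinearMap.mulRight K x)
  have hmem : ∀ u, u ∈ P ↔ u ∈ pure a b ∧ u * x = -(x * u) := by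
    intro u
    simp [P, eq_neg_iff_add_eq_zero, add_comm]
  have hxx0 : x * x ≠ 0 := by simp [hxx, hc]
  obtain ⟨u, hu, d, r, hd, huu, hru⟩ := σ.exists_eigenvector h2 P
    (by
      intro u hu
      rw [hmem] at hu ⊢
      refine ⟨map_mem_pure h2 σ hu.1, ?_⟩
      have h := congr_arg σ.toLinearMap hu.2
      rw [map_neg, AlgInvolution.map_mul_rev', AlgInvolution.map_mul_rev', hsx, mul_smul_comm,
        smul_mul_assoc, ← smul_neg] at h
      have hs0 : ((s : ℤ) : K) ≠ 0 := by
        rcases Int.units_eq_one_or s with rfl | rfl <;> simp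
      rw [smul_right_injective _ hs0 h, neg_neg])
    (fun v hv => ⟨_, mul_self_of_mem_pure ((hmem v).1 hv).1⟩)
    (by
      obtain ⟨u, h1, h2', h3⟩ := exists_anticomm h2 ha hb hx hxx0
      exact ⟨u, (hmem u).2 ⟨h1, h2'⟩, h3⟩)
  have hux := ((hmem u).1 hu).2
  have hσ : σ.toLinearMap (x * u) = (((-(s * r) : ℤˣ) : ℤ) : K) • (x * u) := by
    rw [AlgInvolution.map_mul_rev', hsx, hru, smul_mul_smul_comm, hux]
    push_cast
    module
  have hsq : (x * u) * (x * u) = (-(c * d)) • (1 : QuaternionAlgebra K a 0 b) := by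
    rw [mul_assoc, ← mul_assoc u, hux, neg_mul, mul_assoc x u u, mul_neg, ← mul_assoc, hxx, huu,
      smul_mul_smul_comm, one_mul, neg_smul]
  have hcd : -(c * d) ≠ 0 := neg_ne_zero.2 (mul_ne_zero hc hd)
  by_cases hsr : s = r
  · subst hsr
    exact ⟨x, u, c, d, s, hc, hd, hxx, huu, hux, hsx, hru⟩
  · have hsr' : -(s * r) = 1 := by
      rcases Int.units_eq_one_or s with rfl | rfl <;>
        rcases Int.units_eq_one_or r with rfl | rfl <;> simp_all
    rw [hsr'] at hσ
    by_cases hs : s = 1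
    · subst hs
      refine ⟨x, x * u, c, _, 1, hc, hcd, hxx, hsq, ?_, hsx, hσ⟩
      rw [mul_assoc, hux, mul_neg]
    · have hr : r = 1 := by
        rcases Int.units_eq_one_or s with rfl | rfl <;>
          rcases Int.units_eq_one_or r with rfl | rfl <;> simp_all
      subst hr
      refine ⟨u, x * u, d, _, 1, hd, hcd, huu, hsq, ?_, hru, hσ⟩
      rw [← mul_assoc u, hux, neg_mul, neg_neg]

end QuaternionAlgebra

theorem IsQuaternionAlgebra.exists_isStandardPair {K : Type*} [Field K] (h2 : (2 : K) ≠ 0)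
    {Q : Type*} [Ring Q] [Algebra K Q] (hQ : IsQuaternionAlgebra K Q) (σ : AlgInvolution K Q) :
    ∃ x y a b t, IsStandardPair σ x y a b t := by
  obtain ⟨a, b, ha, hb, ⟨f⟩⟩ := hQ
  obtain ⟨x, y, c, d, t, h⟩ :=
    QuaternionAlgebra.exists_isStandardPair h2 ha hb (σ.transport f)
  refine ⟨f.symm x, f.symm y, c, d, t, h.left_ne, h.right_ne, ?_, ?_, ?_, ?_, ?_⟩
  · rw [← map_mul, h.left_sq, map_smul, map_one]
  · rw [← map_mul, h.right_sq, map_smul, map_one]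
  · rw [← map_mul, h.anticomm, map_neg, map_mul]
  · rw [← map_smul, ← h.map_left, AlgInvolution.transport_apply, f.symm_apply_apply]
  · rw [← map_smul, ← h.map_right, AlgInvolution.transport_apply, f.symm_apply_apply]

theorem IsQuaternionAlgebra.finrank_eq_four {K : Type*} [Field K] {Q : Type*} [Ring Q]
    [Algebra K Q] (hQ : IsQuaternionAlgebra K Q) : Module.finrank K Q = 4 := by
  obtain ⟨a, b, -, -, ⟨f⟩⟩ := hQ
  rw [f.toLinearEquiv.finrank_eq, QuaternionAlgebra.finrank_eq_four]

namespace IsStandardPair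

variable {K : Type*} [Field K] {Q : Type*} [Ring Q] [Algebra K Q] {σ : AlgInvolution K Q}
  {x y : Q} {a b : K} {t : ℤˣ}

theorem mul_mul_left (h : IsStandardPair σ x y a b t) : x * y * x = -(x * (x * y)) := by
  rw [mul_assoc, h.anticomm, mul_neg]

theorem mul_mul_right (h : IsStandardPair σ x y a b t) : x * y * y = -(y * (x * y)) := by
  rw [← mul_assoc y, h.anticomm, neg_mul, neg_neg]

theorem mul_sq (h : IsStandardPair σ x y a b t) : x * y * (x * y) = (-(a * b)) • (1 : Q) := by
  rw [mul_assoc, ← mul_assoc y, h.anticomm, neg_mul, mul_neg, mul_assoc x y y, ← mul_assoc,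
    h.left_sq, h.right_sq, smul_mul_smul_comm, one_mul, neg_smul]

theorem map_mul (h : IsStandardPair σ x y a b t) : σ.toLinearMap (x * y) = -(x * y) := by
  rw [AlgInvolution.map_mul_rev', h.map_left, h.map_right, smul_mul_smul_comm, h.anticomm,
    ← Int.cast_mul, Int.units_coe_mul_self, Int.cast_one, one_smul]

/-- The elements `1, x, y, xy` are linearly independent: conjugation by `x` and by `y` separates
them. -/
theorem linearIndependent [Nontrivial Q] (h2 : (2 : K) ≠ 0) (h : IsStandardPair σ x y a b t) :
    LinearIndependent K ![1, x, y, x * y] := by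
  have cancel_x : ∀ z : Q, x * z = 0 → z = 0 := fun z hz => by
    have := congr_arg (x * ·) hz
    simp only [← mul_assoc, h.left_sq, smul_mul_assoc, one_mul, mul_zero] at this
    exact (smul_eq_zero.1 this).resolve_left h.left_ne
  have cancel_y : ∀ z : Q, y * z = 0 → z = 0 := fun z hz => by
    have := congr_arg (y * ·) hz
    simp only [← mul_assoc, h.right_sq, smul_mul_assoc, one_mul, mul_zero] at this
    exact (smul_eq_zero.1 this).resolve_left h.right_ne
  have hy : y ≠ 0 := fun hy => by
    have := h.right_sq
    rw [hy, mul_zero, eq_comm, smul_eq_zero] at this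
    exact this.elim h.right_ne one_ne_zero
  have hx : x ≠ 0 := fun hx => by
    have := h.left_sq
    rw [hx, mul_zero, eq_comm, smul_eq_zero] at this
    exact this.elim h.left_ne one_ne_zero
  -- an element of `K + K x` that vanishes is trivial, as `x` anticommutes with `y`
  have two : ∀ c d : K, c • (1 : Q) + d • x = 0 → c = 0 ∧ d = 0 := fun c d hcd => by
    have e : (2 * c) • y = y * (c • (1 : Q) + d • x) + (c • (1 : Q) + d • x) * y := by
      rw [mul_add, add_mul, mul_smul_comm, mul_smul_comm, smul_mul_assoc, smul_mul_assoc, mul_one,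
        one_mul, h.anticomm]
      module
    rw [hcd, mul_zero, zero_mul, add_zero, smul_eq_zero] at e
    have hc : c = 0 := (mul_eq_zero.1 (e.resolve_right hy)).resolve_left h2
    rw [hc, zero_smul, zero_add, smul_eq_zero] at hcd
    exact ⟨hc, hcd.resolve_right hx⟩
  rw [Fintype.linearIndependent_iff]
  intro g hg
  simp only [Fin.sum_univ_four, Matrix.cons_val] at hg
  have e : (2 : K) • (x * (g 0 • (1 : Q) + g 1 • x)) =
      x * (g 0 • 1 + g 1 • x + g 2 • y + g 3 • (x * y)) +
        (g 0 • 1 + g 1 • x + g 2 • y + g 3 • (x * y)) * x := by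
    simp only [mul_add, add_mul, mul_smul_comm, smul_mul_assoc, mul_one, one_mul, h.mul_mul_left,
      h.anticomm]
    module
  rw [hg, mul_zero, zero_mul, add_zero, smul_eq_zero] at e
  have h01 := cancel_x _ (e.resolve_left h2)
  obtain ⟨h0, h1⟩ := two _ _ h01
  rw [h01, zero_add] at hg
  have h23 : y * (g 2 • (1 : Q) + (-g 3) • x) = 0 := by
    rw [← hg, mul_add, mul_smul_comm, mul_smul_comm, mul_one, h.anticomm]
    module
  obtain ⟨h2', h3⟩ := two _ _ (cancel_y _ h23)
  intro i
  fin_cases i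
  exacts [h0, h1, h2', neg_eq_zero.1 h3]

/-- The basis `1, x, y, xy` of a quaternion algebra with standard generators `x`, `y`. -/
noncomputable def basis (h : IsStandardPair σ x y a b t) (h2 : (2 : K) ≠ 0)
    (hQ : IsQuaternionAlgebra K Q) : Module.Basis (Fin 4) K Q :=
  haveI : Nontrivial Q := Module.nontrivial_of_finrank_pos (R := K)
    (by rw [hQ.finrank_eq_four]; norm_num)
  basisOfLinearIndependentOfCardEqFinrank (h.linearIndependent h2)
    (by rw [hQ.finrank_eq_four, Fintype.card_fin])

theorem coe_basis (h : IsStandardPair σ x y a b t) (h2 : (2 : K) ≠ 0)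
    (hQ : IsQuaternionAlgebra K Q) : ⇑(h.basis h2 hQ) = ![1, x, y, x * y] := by
  simp [basis]

theorem map_basis (h : IsStandardPair σ x y a b t) (h2 : (2 : K) ≠ 0)
    (hQ : IsQuaternionAlgebra K Q) (i : Fin 4) :
    σ.toLinearMap (h.basis h2 hQ i) =
      (((![1, t, t, -1] i : ℤˣ) : ℤ) : K) • h.basis h2 hQ i := by
  rw [h.coe_basis]
  fin_cases i
  · simp [σ.map_one']
  · simpa using h.map_left
  · simpa using h.map_right
  · simp [h.map_mul]

end IsStandardPair

/-! ### Tournaments with prescribed out-degree parities -/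

/-- The product of all entries of a sign matrix of a tournament counts its edges. -/
theorem prod_prod_tournament (n : ℕ) (f : Fin n → Fin n → ℤˣ) (h1 : ∀ k, f k k = 1)
    (h2 : ∀ k l, k ≠ l → f k l * f l k = -1) :
    ∏ k, ∏ l, f k l = (-1) ^ n.choose 2 := by
  induction n with
  | zero => simp
  | succ n ih =>
    have ih' := ih (fun k l => f k.succ l.succ) (fun k => h1 _)
      (fun k l hkl => h2 _ _ (by simpa using hkl))
    have hstar : (∏ k : Fin n, f 0 k.succ) * ∏ k : Fin n, f k.succ 0 = (-1) ^ n := by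
      rw [← Finset.prod_mul_distrib, Finset.prod_congr rfl
        (fun k _ => h2 0 k.succ (Fin.succ_ne_zero k).symm)]
      simp
    simp_rw [Fin.prod_univ_succ, Finset.prod_mul_distrib]
    rw [ih', h1, one_mul, ← mul_assoc, hstar, ← pow_add, Nat.choose_succ_succ' n 1,
      Nat.choose_one_right]

/-- Out-degree parities of a tournament can be prescribed, subject only to the parity of the number
of edges. The `(k, l)` entry `-1` encodes an edge from `k` to `l`. All parities except that at the
vertex `0` are arranged by orienting the edges at `0`; the last one is then forced. -/
theorem exists_tournament (n : ℕ) (s : Fin n → ℤˣ) (hs : ∏ k, s k = (-1) ^ n.choose 2) :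
    ∃ f : Fin n → Fin n → ℤˣ, (∀ k, f k k = 1) ∧ (∀ k l, k ≠ l → f k l * f l k = -1) ∧
      ∀ k, ∏ l, f k l = s k := by
  cases n with
  | zero => exact ⟨fun _ _ => 1, fun _ => rfl, fun k => k.elim0, fun k => k.elim0⟩
  | succ n =>
    let g : Fin n → Fin n → ℤˣ := fun k l => if l < k then -1 else 1
    let r : Fin n → ℤˣ := fun k => s k.succ * ∏ l, g k l
    let f : Fin (n + 1) → Fin (n + 1) → ℤˣ :=
      Fin.cons (Fin.cons 1 fun l => -r l) fun k => Fin.cons (r k) (g k)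
    have h1 : ∀ k, f k k = 1 := by
      intro k
      refine Fin.cases ?_ (fun k => ?_) k <;> simp [f, g]
    have h2 : ∀ k l, k ≠ l → f k l * f l k = -1 := by
      intro k l
      refine Fin.cases ?_ (fun k => ?_) k <;> refine Fin.cases ?_ (fun l => ?_) l
      · simp
      · intro _
        simp [f, Int.units_mul_self]
      · intro _
        simp [f, Int.units_mul_self]
      · intro hkl
        rcases lt_or_gt_of_ne (show k ≠ l by simpa using hkl) with h | h <;>
          simp [f, g, h, h.not_gt]
    have h3 : ∀ k : Fin n, ∏ l, f k.succ l = s k.succ := by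
      intro k
      simp [f, Fin.prod_univ_succ, r, mul_assoc, Int.units_mul_self]
    refine ⟨f, h1, h2, Fin.cases ?_ h3⟩
    have h := prod_prod_tournament (n + 1) f h1 h2
    rw [← hs, Fin.prod_univ_succ, Fin.prod_univ_succ (f := s),
      Finset.prod_congr rfl (fun k _ => h3 k)] at h
    exact mul_right_cancel h

/-! ### Pure tensors and the dimension of the space of symmetric elements -/

namespace PiTensorProduct

variable {K : Type*} [Field K] {ι : Type*} [Fintype ι] {A : ι → Type*} [∀ i, Ring (A i)]
  [∀ i, Algebra K (A i)]

theorem tprod_eq_prod_smul {u v : ∀ i, A i} (s : ι → K) (h : ∀ i, u i = s i • v i) :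
    tprod K u = (∏ i, s i) • tprod K v := by
  rw [← MultilinearMap.map_smul_univ]
  exact congr_arg _ (funext h)

theorem tprod_mul_tprod_eq_prod_smul {u v : ∀ i, A i} (s : ι → K)
    (h : ∀ i, v i * u i = s i • (u i * v i)) :
    tprod K v * tprod K u = (∏ i, s i) • (tprod K u * tprod K v) := by
  rw [tprod_mul_tprod, tprod_mul_tprod]
  exact tprod_eq_prod_smul s h

/-- A pure tensor lies in every subalgebra that contains its factors. -/
theorem tprod_mem [DecidableEq ι] (R : Subalgebra K (⨂[K] i, A i)) (v : ∀ i, A i)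
    (h : ∀ i, singleAlgHom (R := K) i (v i) ∈ R) : tprod K v ∈ R := by
  suffices H : ∀ s : Finset ι, tprod K (fun i => if i ∈ s then v i else 1) ∈ R by
    simpa using H Finset.univ
  intro s
  induction s using Finset.induction_on with
  | empty =>
    simp only [Finset.notMem_empty, if_false]
    exact R.one_mem
  | insert i s hi ih =>
    have e : tprod K (fun j => if j ∈ insert i s then v j else 1) =
        singleAlgHom (R := K) i (v i) * tprod K (fun j => if j ∈ s then v j else 1) := by
      rw [singleAlgHom_apply, tprod_mul_tprod]
      congr 1
      funext j
      by_cases hj : j = i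
      · subst hj
        simp [hi]
      · simp [hj]
    rw [e]
    exact R.mul_mem (h i) ih

end PiTensorProduct

namespace AlgInvolution

theorem piTensor_tprod {K : Type*} [Field K] {ι : Type*} {A : ι → Type*} [∀ i, Ring (A i)]
    [∀ i, Algebra K (A i)] (σ : ∀ i, AlgInvolution K (A i)) (v : ∀ i, A i) :
    (piTensor σ).toLinearMap (PiTensorProduct.tprod K v) =
      PiTensorProduct.tprod K fun i => (σ i).toLinearMap (v i) :=
  PiTensorProduct.map_tprod _ _

/-- If an involution multiplies the elements of a basis by signs, then twice the dimension of the
space of symmetric elements is the dimension of the algebra plus the sum of the signs. -/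
theorem two_mul_finrank_symmetricElements {K : Type*} [Field K] {B : Type*} [Ring B]
    [Algebra K B] (h2 : (2 : K) ≠ 0) (σ : AlgInvolution K B) {κ : Type*} [Fintype κ]
    (b : Module.Basis κ K B) (s : κ → ℤˣ)
    (h : ∀ i, σ.toLinearMap (b i) = ((s i : ℤ) : K) • b i) :
    2 * (Module.finrank K σ.symmetricElements : ℤ) = Module.finrank K B + ∑ i, (s i : ℤ) := by
  classical
  have hrepr : ∀ x i, b.repr (σ.toLinearMap x) i = ((s i : ℤ) : K) * b.repr x i := by
    intro x i
    conv_lhs => rw [← b.sum_repr x]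
    simp only [map_sum, map_smul, h, Finsupp.coe_finsetSum, Finset.sum_apply]
    simp [Finsupp.single_apply, mul_comm]
  -- the symmetric elements are those supported on the basis elements with sign `1`
  have hspan : σ.symmetricElements =
      Submodule.span K (Set.range fun i : {i // s i = 1} => b i) := by
    apply le_antisymm
    · intro x hx
      have hx' : σ.toLinearMap x = x := hx
      rw [← b.sum_repr x]
      refine Submodule.sum_mem _ fun i _ => ?_
      rcases Int.units_eq_one_or (s i) with hi | hi
      · exact Submodule.smul_mem _ _ (Submodule.subset_span ⟨⟨i, hi⟩, rfl⟩)
      · have hz := hrepr x i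
        rw [hx', hi] at hz
        have hz' : 2 * b.repr x i = 0 := by
          push_cast at hz
          linear_combination hz
        rw [(mul_eq_zero.1 hz').resolve_left h2, zero_smul]
        exact Submodule.zero_mem _
    · rw [Submodule.span_le]
      rintro _ ⟨⟨i, hi⟩, rfl⟩
      change σ.toLinearMap (b i) = b i
      simp [h, hi]
  have hcard : Module.finrank K σ.symmetricElements = Fintype.card {i // s i = 1} := by
    rw [hspan]
    exact finrank_span_eq_card (b.linearIndependent.comp _ Subtype.val_injective)
  rw [hcard, Module.finrank_eq_card_basis b, Fintype.card_subtype, Finset.card_filter,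
    ← Finset.card_univ, Finset.card_eq_sum_ones]
  push_cast
  rw [Finset.mul_sum, ← Finset.sum_add_distrib]
  refine Finset.sum_congr rfl fun i _ => ?_
  rcases Int.units_eq_one_or (s i) with hi | hi <;> simp [hi]

end AlgInvolution

/-! ### Anticommuting generators of a tensor product of quaternion algebras -/

namespace QuaternionTensor

variable {K : Type*} [Field K] {n : ℕ} {Q : Fin n → Type*} [∀ i, Ring (Q i)]
  [∀ i, Algebra K (Q i)] {σ : ∀ i, AlgInvolution K (Q i)} {x y : ∀ i, Q i} {a b : Fin n → K}
  {t : Fin n → ℤˣ}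

section Dimension

variable (h2 : (2 : K) ≠ 0) (hQ : ∀ i, IsQuaternionAlgebra K (Q i))
  (h : ∀ i, IsStandardPair (σ i) (x i) (y i) (a i) (b i) (t i))

include h2 hQ h

theorem finrank_eq : Module.finrank K (⨂[K] i, Q i) = (2 ^ n) ^ 2 := by
  rw [Module.finrank_eq_card_basis (Basis.piTensorProduct fun i => (h i).basis h2 (hQ i))]
  simp [← pow_mul, mul_comm n 2, pow_mul 2 2 n]

theorem two_mul_finrank_symmetricElements :
    2 * (Module.finrank K (AlgInvolution.piTensor σ).symmetricElements : ℤ) =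
      2 ^ n * (2 ^ n + ((∏ i, t i : ℤˣ) : ℤ)) := by
  rw [AlgInvolution.two_mul_finrank_symmetricElements h2 (AlgInvolution.piTensor σ)
    (Basis.piTensorProduct fun i => (h i).basis h2 (hQ i))
    (fun p => ∏ i, (![1, t i, t i, -1] : Fin 4 → ℤˣ) (p i)), finrank_eq h2 hQ h]
  · have hsum : ∑ p : Fin n → Fin 4,
        ((∏ i, (![1, t i, t i, -1] : Fin 4 → ℤˣ) (p i) : ℤˣ) : ℤ) =
        2 ^ n * ((∏ i, t i : ℤˣ) : ℤ) := by
      simp only [Units.coe_prod]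
      rw [← Fintype.prod_sum fun i j => (((![1, t i, t i, -1] : Fin 4 → ℤˣ) j : ℤˣ) : ℤ)]
      have : ∀ i, ∑ j, (((![1, t i, t i, -1] : Fin 4 → ℤˣ) j : ℤˣ) : ℤ) = 2 * (t i : ℤ) := by
        intro i
        simp [Fin.sum_univ_four]
        ring
      simp [this, Finset.prod_mul_distrib]
    rw [hsum]
    push_cast
    ring
  · intro p
    rw [Basis.piTensorProduct_apply, AlgInvolution.piTensor_tprod,
      PiTensorProduct.tprod_eq_prod_smul _ fun i => (h i).map_basis h2 (hQ i) (p i)]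
    push_cast
    rfl

theorem prod_sign_of_isSymplectic (hs : (AlgInvolution.piTensor σ).IsSymplectic) :
    ∏ i, t i = -1 := by
  obtain ⟨d, hd, hsym⟩ := hs
  rw [finrank_eq h2 hQ h] at hd
  obtain rfl : 2 ^ n = d := Nat.pow_left_injective two_ne_zero hd
  have key := two_mul_finrank_symmetricElements h2 hQ h
  rcases Int.units_eq_one_or (∏ i, t i) with ht | ht
  · rw [ht] at key
    have h1 : 1 ≤ 2 ^ n := Nat.one_le_two_pow
    zify [h1] at hsym
    rw [hsym, Units.val_one] at key
    have := mul_left_cancel₀ (by positivity) key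
    omega
  · exact ht

theorem prod_sign_of_isOrthogonal (hs : (AlgInvolution.piTensor σ).IsOrthogonal) :
    ∏ i, t i = 1 := by
  obtain ⟨d, hd, hsym⟩ := hs
  rw [finrank_eq h2 hQ h] at hd
  obtain rfl : 2 ^ n = d := Nat.pow_left_injective two_ne_zero hd
  have key := two_mul_finrank_symmetricElements h2 hQ h
  rcases Int.units_eq_one_or (∏ i, t i) with ht | ht
  · exact ht
  · rw [ht] at key
    zify at hsym
    rw [hsym, Units.val_neg, Units.val_one] at key
    have := mul_left_cancel₀ (by positivity) key
    omega

end Dimension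

/-- The pure tensor with factor `g k` at `k` and factors `w l` at those `l ≠ k` for which there is
an edge from `k` to `l`, i.e. `f k l = -1`. When `w` anticommutes with every `g`, the two factors at
`k` and `m` of a product of twists at `k ≠ m` contribute the signs `f m k` and `f k m` under
commutation, of which exactly one is `-1` in a tournament. -/
noncomputable def twist (K : Type*) [Field K] {n : ℕ} {Q : Fin n → Type*} [∀ i, Ring (Q i)]
    [∀ i, Algebra K (Q i)] (f : Fin n → Fin n → ℤˣ) (w g : ∀ i, Q i) (k : Fin n) : ⨂[K] i, Q i :=
  PiTensorProduct.tprod K fun l => if l = k then g l else if f k l = -1 then w l else 1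

variable {f : Fin n → Fin n → ℤˣ} {w g g' : ∀ i, Q i}

/-- Twisted elements at different places anticommute if every `g` anticommutes with `w`. -/
theorem twist_mul_twist_of_ne (hf : ∀ k l, k ≠ l → f k l * f l k = -1)
    (hg : ∀ i, w i * g i = -(g i * w i)) (hg' : ∀ i, w i * g' i = -(g' i * w i)) {k m : Fin n}
    (hkm : k ≠ m) :
    twist K f w g' m * twist K f w g k = -(twist K f w g k * twist K f w g' m) := by
  have e := PiTensorProduct.tprod_mul_tprod_eq_prod_smul (K := K)
    (u := fun l => if l = k then g l else if f k l = -1 then w l else 1)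
    (v := fun l => if l = m then g' l else if f m l = -1 then w l else 1)
    (fun l => (if l = k then ((f m k : ℤ) : K) else 1) *
      (if l = m then ((f k m : ℤ) : K) else 1))
    (by
      intro l
      by_cases hk : l = k
      · subst hk
        rcases Int.units_eq_one_or (f m l) with h | h <;> simp [hkm, h, hg]
      · by_cases hm : l = m
        · subst hm
          rcases Int.units_eq_one_or (f k l) with h | h <;> simp [hkm.symm, h, hg']
        · simp only [hk, hm, if_false, one_mul, one_smul]
          split_ifs <;> simp)
  rw [twist, twist, e, Finset.prod_mul_distrib, Finset.prod_ite_eq' Finset.univ k,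
    Finset.prod_ite_eq' Finset.univ m, if_pos (Finset.mem_univ _), if_pos (Finset.mem_univ _),
    ← Int.cast_mul, ← Units.val_mul, hf m k hkm.symm]
  simp

/-- Twisted elements at the same place anticommute if their factors do. -/
theorem twist_mul_twist_same (hg : ∀ i, g' i * g i = -(g i * g' i)) (k : Fin n) :
    twist K f w g' k * twist K f w g k = -(twist K f w g k * twist K f w g' k) := by
  have e := PiTensorProduct.tprod_mul_tprod_eq_prod_smul (K := K)
    (u := fun l => if l = k then g l else if f k l = -1 then w l else 1)
    (v := fun l => if l = k then g' l else if f k l = -1 then w l else 1)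
    (fun l => if l = k then -1 else 1)
    (by
      intro l
      by_cases hk : l = k
      · simp [hk, hg]
      · simp [hk])
  rw [twist, twist, e]
  simp

theorem exists_twist_mul_twist {c : Fin n → K} (hc : ∀ i, c i ≠ 0)
    (hw : ∀ i, w i * w i = c i • (1 : Q i)) (g g' : ∀ i, Q i) (k : Fin n) :
    ∃ d : K, d ≠ 0 ∧ twist K f w g k * twist K f w g' k =
      d • PiTensorProduct.singleAlgHom (R := K) k (g k * g' k) := by
  refine ⟨∏ l, if l = k then 1 else if f k l = -1 then c l else 1, ?_, ?_⟩
  · refine Finset.prod_ne_zero_iff.2 fun l _ => ?_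
    split_ifs
    exacts [one_ne_zero, hc l, one_ne_zero]
  · rw [twist, twist, PiTensorProduct.tprod_mul_tprod, PiTensorProduct.singleAlgHom_apply]
    refine PiTensorProduct.tprod_eq_prod_smul _ fun l => ?_
    by_cases hk : l = k
    · subst hk
      simp
    · by_cases hf : f k l = -1 <;> simp [hk, hf, hw]

theorem exists_twist_sq {c d : Fin n → K} (hc : ∀ i, c i ≠ 0) (hd : ∀ i, d i ≠ 0)
    (hw : ∀ i, w i * w i = c i • (1 : Q i)) (hg : ∀ i, g i * g i = d i • (1 : Q i)) (k : Fin n) :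
    ∃ r : K, r ≠ 0 ∧ twist K f w g k * twist K f w g k = r • (1 : ⨂[K] i, Q i) := by
  obtain ⟨r, hr, e⟩ := exists_twist_mul_twist (f := f) hc hw g g k
  refine ⟨r * d k, mul_ne_zero hr (hd k), ?_⟩
  rw [e, hg, map_smul, map_one, smul_smul]

theorem piTensor_twist (hf : ∀ k, f k k = 1) (hw : ∀ i, (σ i).toLinearMap (w i) = -w i)
    (hg : ∀ i, (σ i).toLinearMap (g i) = ((t i : ℤ) : K) • g i) (k : Fin n) :
    (AlgInvolution.piTensor σ).toLinearMap (twist K f w g k) =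
      (((t k * ∏ l, f k l : ℤˣ) : ℤ) : K) • twist K f w g k := by
  rw [twist, AlgInvolution.piTensor_tprod, PiTensorProduct.tprod_eq_prod_smul
    (fun l => (if l = k then ((t k : ℤ) : K) else 1) * ((f k l : ℤ) : K))]
  · rw [Finset.prod_mul_distrib, Finset.prod_ite_eq' Finset.univ k, if_pos (Finset.mem_univ _)]
    push_cast
    rfl
  · intro l
    by_cases hk : l = k
    · subst hk
      simp [hf, hg]
    · rcases Int.units_eq_one_or (f k l) with h | h <;>
        simp [hk, h, hw, AlgInvolution.map_one']

/-- The twisted standard generators generate the tensor product: first `x_k y_k`, being a multiple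
of the product of the two generators at `k`, and then the untwisted `x_k` and `y_k`. -/
theorem adjoin_twist (h2 : (2 : K) ≠ 0) (hQ : ∀ i, IsQuaternionAlgebra K (Q i))
    (h : ∀ i, IsStandardPair (σ i) (x i) (y i) (a i) (b i) (t i))
    (R : Subalgebra K (⨂[K] i, Q i)) (hx : ∀ k, twist K f (x * y) x k ∈ R)
    (hy : ∀ k, twist K f (x * y) y k ∈ R) : R = ⊤ := by
  have hc : ∀ i, -(a i * b i) ≠ 0 := fun i =>
    neg_ne_zero.2 (mul_ne_zero (h i).left_ne (h i).right_ne)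
  have hsq : ∀ i, (x * y) i * (x * y) i = (-(a i * b i)) • (1 : Q i) := fun i => (h i).mul_sq
  have cancel : ∀ {d : K} {z : ⨂[K] i, Q i}, d ≠ 0 → d • z ∈ R → z ∈ R := fun hd hz =>
    (Submodule.smul_mem_iff (Subalgebra.toSubmodule R) hd).1 hz
  have hw : ∀ k, PiTensorProduct.singleAlgHom (R := K) k ((x * y) k) ∈ R := fun k => by
    obtain ⟨d, hd, e⟩ := exists_twist_mul_twist (f := f) hc hsq x y k
    exact cancel hd (e ▸ R.mul_mem (hx k) (hy k))
  have hone : ∀ k, twist K f (x * y) 1 k ∈ R := fun k => by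
    refine PiTensorProduct.tprod_mem R _ fun l => ?_
    split_ifs
    · rw [Pi.one_apply, map_one]
      exact R.one_mem
    · exact hw l
    · rw [map_one]
      exact R.one_mem
  have hsingle : ∀ (g : ∀ i, Q i), (∀ k, twist K f (x * y) g k ∈ R) →
      ∀ k, PiTensorProduct.singleAlgHom (R := K) k (g k) ∈ R := fun g hg k => by
    obtain ⟨d, hd, e⟩ := exists_twist_mul_twist (f := f) hc hsq g 1 k
    rw [Pi.one_apply, mul_one] at e
    exact cancel hd (e ▸ R.mul_mem (hg k) (hone k))
  have hbasis : ∀ p, Basis.piTensorProduct (fun i => (h i).basis h2 (hQ i)) p ∈ R := by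
    intro p
    rw [Basis.piTensorProduct_apply]
    refine PiTensorProduct.tprod_mem R _ fun i => ?_
    rw [(h i).coe_basis]
    generalize p i = j
    fin_cases j
    · change PiTensorProduct.singleAlgHom (R := K) i 1 ∈ R
      rw [map_one]
      exact R.one_mem
    · exact hsingle x hx i
    · exact hsingle y hy i
    · exact hw i
  rw [← Algebra.toSubmodule_eq_top, eq_top_iff,
    ← (Basis.piTensorProduct fun i => (h i).basis h2 (hQ i)).span_eq, Submodule.span_le]
  rintro _ ⟨p, rfl⟩
  exact hbasis p

end QuaternionTensor

/-! ### Clifford algebras of diagonal forms -/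

namespace CliffordAlgebra

variable {K : Type*} [Field K]

theorem finrank_eq_two_pow (h2 : (2 : K) ≠ 0) {ι : Type*} [Fintype ι]
    (q : QuadraticForm K (ι → K)) :
    Module.finrank K (CliffordAlgebra q) = 2 ^ Fintype.card ι := by
  classical
  have := invertibleOfNonzero h2
  let : LinearOrder ι := LinearOrder.lift' (Fintype.equivFin ι) (Fintype.equivFin ι).injective
  rw [(equivExterior q).finrank_eq,
    Module.finrank_eq_card_basis (Pi.basisFun K ι).ExteriorAlgebra, Fintype.card_finset]

variable {A : Type*} [Ring A] [Algebra K A] {ι : Type*} [Fintype ι]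

/-- An algebra of dimension `2 ^ |ι|` generated by anticommuting elements `e i`, `i ∈ ι`, with
nonzero scalar squares is the Clifford algebra of the corresponding diagonal form. -/
theorem exists_algEquiv_of_anticomm (h2 : (2 : K) ≠ 0) (e : ι → A) (c : ι → K)
    (hsq : ∀ i, e i * e i = c i • (1 : A)) (hanti : ∀ i j, i ≠ j → e j * e i = -(e i * e j))
    (hgen : Algebra.adjoin K (Set.range e) = ⊤)
    (hdim : Module.finrank K A = 2 ^ Fintype.card ι) :
    ∃ f : CliffordAlgebra (QuadraticMap.weightedSumSquares K c) ≃ₐ[K] A,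
      ∀ v, f (CliffordAlgebra.ι _ v) = ∑ i, v i • e i := by
  classical
  let φ : (ι → K) →ₗ[K] A := Fintype.linearCombination K e
  have hφ : ∀ v, φ v = ∑ i, v i • e i := fun v => Fintype.linearCombination_apply K e v
  have hφsq : ∀ v, φ v * φ v = algebraMap K A (QuadraticMap.weightedSumSquares K c v) := by
    intro v
    -- it suffices to compare twice both sides, which symmetrizes the double sum
    have hdouble : (2 : K) • (φ v * φ v) =
        (2 : K) • algebraMap K A (QuadraticMap.weightedSumSquares K c v) := by
      have hl : φ v * φ v = ∑ i, ∑ j, (v i * v j) • (e i * e j) := by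
        simp_rw [hφ, Finset.sum_mul, Finset.mul_sum, smul_mul_smul_comm]
      have hl' : φ v * φ v = ∑ i, ∑ j, (v i * v j) • (e j * e i) := by
        rw [hl, Finset.sum_comm]
        refine Finset.sum_congr rfl fun i _ => Finset.sum_congr rfl fun j _ => ?_
        rw [mul_comm (v j)]
      rw [two_smul, two_smul]
      nth_rewrite 1 [hl]
      rw [hl']
      simp_rw [← Finset.sum_add_distrib, ← smul_add]
      rw [QuadraticMap.weightedSumSquares_apply, map_sum, ← Finset.sum_add_distrib]
      refine Finset.sum_congr rfl fun i _ => ?_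
      rw [Finset.sum_eq_single i]
      · rw [hsq, Algebra.algebraMap_eq_smul_one]
        module
      · intro j _ hj
        rw [hanti i j hj.symm, add_neg_cancel, smul_zero]
      · simp
    exact smul_right_injective A h2 hdouble
  let F := CliffordAlgebra.lift (QuadraticMap.weightedSumSquares K c) ⟨φ, hφsq⟩
  have hF : ∀ v, F (CliffordAlgebra.ι _ v) = ∑ i, v i • e i := fun v => by
    rw [CliffordAlgebra.lift_ι_apply, hφ]
  have hsurj : Function.Surjective F := by
    rw [← AlgHom.range_eq_top, eq_top_iff, ← hgen, Algebra.adjoin_le_iff]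
    rintro _ ⟨i, rfl⟩
    refine ⟨CliffordAlgebra.ι _ (Pi.single i 1), ?_⟩
    change F _ = _
    rw [hF]
    simp [Pi.single_apply]
  have hfin : Module.finrank K (CliffordAlgebra (QuadraticMap.weightedSumSquares K c)) =
      Module.finrank K A := by
    rw [finrank_eq_two_pow h2, hdim]
  have : FiniteDimensional K A := Module.finite_of_finrank_pos (by rw [hdim]; positivity)
  have : FiniteDimensional K (CliffordAlgebra (QuadraticMap.weightedSumSquares K c)) :=
    Module.finite_of_finrank_pos (by rw [hfin, hdim]; positivity)
  have hinj : Function.Injective F :=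
    (LinearMap.injective_iff_surjective_of_finrank_eq_finrank (f := F.toLinearMap) hfin).2 hsurj
  exact ⟨AlgEquiv.ofBijective F ⟨hinj, hsurj⟩, hF⟩

end CliffordAlgebra

theorem QuadraticMap.polarBilin_weightedSumSquares_nondegenerate {K : Type*} [Field K]
    (h2 : (2 : K) ≠ 0) {ι : Type*} [Fintype ι] (c : ι → K) (hc : ∀ i, c i ≠ 0) :
    (QuadraticMap.weightedSumSquares K c).polarBilin.Nondegenerate := by
  classical
  have key : ∀ (v : ι → K) (i : ι),
      QuadraticMap.polar (QuadraticMap.weightedSumSquares K c) v (Pi.single i 1) =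
        2 * c i * v i := by
    intro v i
    simp only [QuadraticMap.polar, QuadraticMap.weightedSumSquares_apply,
      ← Finset.sum_sub_distrib]
    rw [Finset.sum_eq_single i]
    · simp
      ring
    · intro j _ hj
      simp [hj]
    · simp
  have cancel : ∀ (v : ι → K) (i : ι), 2 * c i * v i = 0 → v i = 0 := fun v i h =>
    (mul_eq_zero.1 h).resolve_left (mul_ne_zero h2 (hc i))
  refine ⟨fun v hv => funext fun i => cancel v i ?_, fun v hv => funext fun i => cancel v i ?_⟩
  · rw [← key]
    exact hv _
  · rw [← key, QuadraticMap.polar_comm]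
    exact hv _

/-- An isomorphism from a Clifford algebra respects the involutions as soon as it does so on the
generating quadratic space. -/
theorem AlgInvolution.isomorphic_cliffordInvolution {K : Type*} [Field K] {A : Type*} [Ring A]
    [Algebra K A] (τ : AlgInvolution K A) {V : Type*} [AddCommGroup V] [Module K V]
    {q : QuadraticForm K V} (s : OrthogonalSymmetry q) (f : CliffordAlgebra q ≃ₐ[K] A)
    (hf : ∀ v, τ.toLinearMap (f (CliffordAlgebra.ι q v)) =
      f (CliffordAlgebra.ι q (s.toIsometry v))) :
    τ.Isomorphic s.cliffordInvolution := by
  refine ⟨f.symm, fun x => ?_⟩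
  have h := s.cliffordInvolution_unique (τ.transport f.symm)
    (fun v => by rw [transport_apply, AlgEquiv.symm_symm, hf, f.symm_apply_apply]) (f.symm x)
  rw [← h, transport_apply, AlgEquiv.symm_symm, f.apply_symm_apply]

/-! ### The tensor product as a Clifford algebra -/

namespace QuaternionTensor

/-- If the signs `t k` of the factors satisfy `∏ (ε t k) = (-1) ^ (n choose 2)`, then the tensor
product is a Clifford algebra on whose generating space the involution is `ε`. -/
theorem exists_cliffordAlgebra {K : Type u} [Field K] (h2 : (2 : K) ≠ 0) {n : ℕ}
    {Q : Fin n → Type v} [∀ i, Ring (Q i)] [∀ i, Algebra K (Q i)]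
    (hQ : ∀ i, IsQuaternionAlgebra K (Q i)) {σ : ∀ i, AlgInvolution K (Q i)} {x y : ∀ i, Q i}
    {a b : Fin n → K} {t : Fin n → ℤˣ}
    (h : ∀ i, IsStandardPair (σ i) (x i) (y i) (a i) (b i) (t i)) (ε : ℤˣ)
    (hε : ∏ k, ε * t k = (-1) ^ n.choose 2) :
    ∃ (V : Type u) (_ : AddCommGroup V) (_ : Module K V) (q : QuadraticForm K V),
      FiniteDimensional K V ∧ Module.finrank K V = 2 * n ∧ q.polarBilin.Nondegenerate ∧
      ∀ s : OrthogonalSymmetry q, (∀ v, s.toIsometry v = ((ε : ℤ) : K) • v) →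
        (AlgInvolution.piTensor σ).Isomorphic s.cliffordInvolution := by
  obtain ⟨f, hf1, hf2, hf3⟩ := exists_tournament n _ hε
  let w : ∀ i, Q i := x * y
  let g : Bool → ∀ i, Q i := fun β => bif β then x else y
  let d : Bool → Fin n → K := fun β => bif β then a else b
  have hd : ∀ β i, d β i ≠ 0 := by
    rintro (_ | _) i
    exacts [(h i).right_ne, (h i).left_ne]
  have hg : ∀ β i, g β i * g β i = d β i • (1 : Q i) := by
    rintro (_ | _) i
    exacts [(h i).right_sq, (h i).left_sq]
  have hwg : ∀ β i, w i * g β i = -(g β i * w i) := by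
    rintro (_ | _) i
    exacts [(h i).mul_mul_right, (h i).mul_mul_left]
  have hσg : ∀ β i, (σ i).toLinearMap (g β i) = ((t i : ℤ) : K) • g β i := by
    rintro (_ | _) i
    exacts [(h i).map_right, (h i).map_left]
  let e : Fin n × Bool → ⨂[K] i, Q i := fun p => twist K f w (g p.2) p.1
  have hsq : ∀ p, ∃ r : K, r ≠ 0 ∧ e p * e p = r • (1 : ⨂[K] i, Q i) := fun p =>
    exists_twist_sq (fun i => neg_ne_zero.2 (mul_ne_zero (h i).left_ne (h i).right_ne)) (hd p.2)
      (fun i => (h i).mul_sq) (hg p.2) p.1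
  choose c hc hec using hsq
  have hanti : ∀ p r, p ≠ r → e r * e p = -(e p * e r) := by
    rintro ⟨k, β⟩ ⟨m, γ⟩ hne
    by_cases hkm : k = m
    · subst hkm
      rcases β with _ | _ <;> rcases γ with _ | _
      · exact absurd rfl hne
      · exact twist_mul_twist_same (fun i => by simp [g, (h i).anticomm]) k
      · exact twist_mul_twist_same (fun i => (h i).anticomm) k
      · exact absurd rfl hne
    · exact twist_mul_twist_of_ne hf2 (hwg β) (hwg γ) hkm
  have hσ : ∀ p, (AlgInvolution.piTensor σ).toLinearMap (e p) = ((ε : ℤ) : K) • e p := by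
    rintro ⟨k, β⟩
    have := piTensor_twist hf1 (fun i => (h i).map_mul) (hσg β) k
    rwa [hf3, mul_left_comm, Int.units_mul_self, mul_one] at this
  have hgen : Algebra.adjoin K (Set.range e) = ⊤ :=
    adjoin_twist (f := f) h2 hQ h _ (fun k => Algebra.subset_adjoin ⟨(k, true), rfl⟩)
      (fun k => Algebra.subset_adjoin ⟨(k, false), rfl⟩)
  obtain ⟨F, hF⟩ := CliffordAlgebra.exists_algEquiv_of_anticomm h2 e c hec hanti hgen
    (by
      rw [finrank_eq h2 hQ h, ← pow_mul]
      simp)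
  refine ⟨Fin n × Bool → K, inferInstance, inferInstance, QuadraticMap.weightedSumSquares K c,
    inferInstance, ?_, QuadraticMap.polarBilin_weightedSumSquares_nondegenerate h2 c hc,
    fun s hs => AlgInvolution.isomorphic_cliffordInvolution _ s F fun v => ?_⟩
  · simp [mul_comm]
  · rw [hs, hF, map_smul, map_smul, hF, map_sum, Finset.smul_sum]
    refine Finset.sum_congr rfl fun p _ => ?_
    rw [map_smul, hσ, smul_comm]

end QuaternionTensor

theorem Odd.neg_one_pow_choose_two {n : ℕ} (hn : Odd n) :
    ((-1) ^ n.choose 2 : ℤˣ) = (-1) ^ (n / 2) := by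
  obtain ⟨m, rfl⟩ := hn
  have h1 : (2 * m + 1).choose 2 = (2 * m + 1) * m := by
    rw [Nat.choose_two_right, Nat.add_sub_cancel, mul_left_comm, Nat.mul_div_cancel_left _ two_pos]
  have h2 : (2 * m + 1) / 2 = m := by omega
  rw [h1, h2, pow_mul, Odd.neg_one_pow ⟨m, rfl⟩]

theorem proposition6p7 {K : Type u} [Field K] (hK : ringChar K ≠ 2)
    (n : ℕ) (hn : Odd n)
    (Q : Fin n → Type v) [∀ i, Ring (Q i)] [∀ i, Algebra K (Q i)]
    (hQ : ∀ i, IsQuaternionAlgebra K (Q i)) (σ : ∀ i, AlgInvolution K (Q i)) :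
    (n % 4 = 1 → (AlgInvolution.piTensor σ).IsSymplectic →
      ∃ (V : Type u) (_ : AddCommGroup V) (_ : Module K V) (q : QuadraticForm K V),
        FiniteDimensional K V ∧ Module.finrank K V = 2 * n ∧ q.polarBilin.Nondegenerate ∧
        (AlgInvolution.piTensor σ).Isomorphic
          (OrthogonalSymmetry.negId q).cliffordInvolution) ∧
    (n % 4 = 1 → (AlgInvolution.piTensor σ).IsOrthogonal →
      ∃ (V : Type u) (_ : AddCommGroup V) (_ : Module K V) (q : QuadraticForm K V),
        FiniteDimensional K V ∧ Module.finrank K V = 2 * n ∧ q.polarBilin.Nondegenerate ∧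
        (AlgInvolution.piTensor σ).Isomorphic
          (OrthogonalSymmetry.id q).cliffordInvolution) ∧
    (n % 4 = 3 → (AlgInvolution.piTensor σ).IsSymplectic →
      ∃ (V : Type u) (_ : AddCommGroup V) (_ : Module K V) (q : QuadraticForm K V),
        FiniteDimensional K V ∧ Module.finrank K V = 2 * n ∧ q.polarBilin.Nondegenerate ∧
        (AlgInvolution.piTensor σ).Isomorphic
          (OrthogonalSymmetry.id q).cliffordInvolution) ∧
    (n % 4 = 3 → (AlgInvolution.piTensor σ).IsOrthogonal →
      ∃ (V : Type u) (_ : AddCommGroup V) (_ : Module K V) (q : QuadraticForm K V),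
        FiniteDimensional K V ∧ Module.finrank K V = 2 * n ∧ q.polarBilin.Nondegenerate ∧
        (AlgInvolution.piTensor σ).Isomorphic
          (OrthogonalSymmetry.negId q).cliffordInvolution) := by
  have h2 : (2 : K) ≠ 0 := Ring.two_ne_zero hK
  choose x y a b t h using fun i => (hQ i).exists_isStandardPair h2 (σ i)
  have hprod : ∀ ε : ℤˣ, ∏ k, ε * t k = ε * ∏ k, t k := fun ε => by
    rw [Finset.prod_mul_distrib, Finset.prod_const, Finset.card_univ, Fintype.card_fin]
    congr 1
    rcases Int.units_eq_one_or ε with rfl | rfl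
    exacts [one_pow n, hn.neg_one_pow]
  have h1 : n % 4 = 1 → ((-1) ^ n.choose 2 : ℤˣ) = 1 := fun hmod => by
    rw [hn.neg_one_pow_choose_two, Even.neg_one_pow (by rw [Nat.even_iff]; omega)]
  have h3 : n % 4 = 3 → ((-1) ^ n.choose 2 : ℤˣ) = -1 := fun hmod => by
    rw [hn.neg_one_pow_choose_two, Odd.neg_one_pow (by rw [Nat.odd_iff]; omega)]
  have pos : ∏ k, t k = (-1) ^ n.choose 2 →
      ∃ (V : Type u) (_ : AddCommGroup V) (_ : Module K V) (q : QuadraticForm K V),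
        FiniteDimensional K V ∧ Module.finrank K V = 2 * n ∧ q.polarBilin.Nondegenerate ∧
        (AlgInvolution.piTensor σ).Isomorphic
          (OrthogonalSymmetry.id q).cliffordInvolution := fun ht => by
    obtain ⟨V, i1, i2, q, hV, hdim, hq, hiso⟩ :=
      QuaternionTensor.exists_cliffordAlgebra h2 hQ h 1 (by rw [hprod, one_mul, ht])
    refine ⟨V, i1, i2, q, hV, hdim, hq, hiso _ fun v => ?_⟩
    simp [OrthogonalSymmetry.id]
  have neg : -∏ k, t k = (-1) ^ n.choose 2 →
      ∃ (V : Type u) (_ : AddCommGroup V) (_ : Module K V) (q : QuadraticForm K V),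
        FiniteDimensional K V ∧ Module.finrank K V = 2 * n ∧ q.polarBilin.Nondegenerate ∧
        (AlgInvolution.piTensor σ).Isomorphic
          (OrthogonalSymmetry.negId q).cliffordInvolution := fun ht => by
    obtain ⟨V, i1, i2, q, hV, hdim, hq, hiso⟩ :=
      QuaternionTensor.exists_cliffordAlgebra h2 hQ h (-1) (by rw [hprod, neg_one_mul, ht])
    refine ⟨V, i1, i2, q, hV, hdim, hq, hiso _ fun v => ?_⟩
    rw [Units.val_neg, Units.val_one, Int.cast_neg, Int.cast_one, neg_one_smul]
    rfl
  have hsymp := QuaternionTensor.prod_sign_of_isSymplectic h2 hQ h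
  have horth := QuaternionTensor.prod_sign_of_isOrthogonal h2 hQ h
  refine ⟨fun hm hs => neg ?_, fun hm hs => pos ?_, fun hm hs => pos ?_, fun hm hs => neg ?_⟩
  · rw [hsymp hs, h1 hm, neg_neg]
  · rw [horth hs, h1 hm]
  · rw [hsymp hs, h3 hm]
  · rw [horth hs, h3 hm]
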